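/- Let $0<\varepsilon<1/8$. Construct a sequence of polygonal paths in $\mathbb{R}^2$ as follows. Let $A_{0,1}$ be the segment from $(0,0)$ to $(1,0)$. Given the segments $A_{n,1},\dots,A_{n,2^n}$ of generation $n$ (numbered from left to right along the path), let $T_{n,i}$ be the closed isosceles triangle ("cap") with base $A_{n,i}$, height $2^{1-n}\varepsilon$ and new vertex $a_{n,i}$ over the midpoint of the base, where $T_{0,1}$ points upwards and, for $n\ge 1$, $T_{n,i}$ lies inside the cap of generation $n-1$ of which $A_{n,i}$ is a side; the segments $A_{n+1,2i-1},A_{n+1,2i}$ are the two shorter sides of $T_{n,i}$. Let $\theta_{n,i}$ be the base angle of $T_{n,i}$, let $A_n=\bigcup_{i=1}^{2^n}A_{n,i}$, and let $$A_\varepsilon=\overline{\bigcup_{n\ge1}A_n}\setminus\bigcup_{n\ge1}A_n .$$ Enumerate the edge points as $e_1=(0,0)$, $e_2=(1,0)$, $e_{1+2^n+i}=a_{n,i}$ for $n\ge 0$, $1\le i\le 2^n$. Put $\rho_k=4^{1-k}\cdot\tfrac14\,2^{-7}(1+112\,\varepsilon^2)^{1/2}$, $r_1=\rho_1$, $r_2=\rho_2$,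 and for $k\ge3$, with $n\ge 0$ determined by $2^{n+1}+1\le k\le 2^{n+2}$, put $r_k=\min\{\rho_k,\ \tfrac12 d(e_k,A_{n-1}\cup A_{n-2})\}$, where $A_m=\emptyset$ for $m<0$ and $d(\cdot,\emptyset)=\infty$. Let $$\mathcal{A}_\varepsilon=A_\varepsilon\setminus\bigcup_{k\ge1}B_{r_k}(e_k),$$ where $B_r(e)$ is the open ball. A set $M\subset\mathbb{R}^2$ is countably 1-rectifiable if $M\subset M_0\cup\bigcup_{j\ge1}F_j(\mathbb{R})$ with $\mathcal{H}^1(M_0)=0$ and $F_j:\mathbb{R}\to\mathbb{R}^2$ Lipschitz. Then: 1. Every $x\in A_\varepsilon$ lies, for each $n$, in exactly one cap $T_{n,i(n,x)}$ of generation $n$, and the stretch product is identically infinite on $A_\varepsilon$: $$\prod_{n=0}^{\infty}\frac1{\cos\theta_{n,i(n,x)}}=\infty\quad\text{for all }x\in A_\varepsilon .$$ Likewise, for every $t\in[0,1]$ in the base, $\prod_{n=0}^\infty 1/\cos\theta_{n,i(n,t)}=\infty$, where $i(n,t)$ is the index of the dyadic interval $[(i-1)2^{-n},i2^{-n}]$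 that contains $t$ (the right-hand one if there are two). 2. $A_\varepsilon$ is not countably 1-rectifiable. 3. The subset $\mathcal{A}_\varepsilon\subset A_\varepsilon$ is closed and is not countably 1-rectifiable. -/

import Mathlib

open Set Filter Topology MeasureTheory
open scoped MeasureTheory

namespace Koch

noncomputable section

/-! The plane `ℝ²` is identified with `ℂ`, which carries the Euclidean metric. -/

/-- `M` is countably 1-rectifiable: up to a set of vanishing one-dimensional Hausdorff measure it
is covered by countably many Lipschitz images of the line. No measurability is required. -/
def CountablyOneRectifiable (M : Set ℂ) : Prop :=
  ∃ (M₀ : Set ℂ) (F : ℕ → ℝ → ℂ),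
    μH[1] M₀ = 0 ∧ (∀ j, ∃ K, LipschitzWith K (F j)) ∧ M ⊆ M₀ ∪ ⋃ j, range (F j)

/-- The vertical height `2 ^ (1 - n) * ε` of the caps of generation `n`. -/
def height (ε : ℝ) (n : ℕ) : ℝ := 2 * ε / 2 ^ n

/-- The new vertex of the triangular cap of height `h` over the segment from `l` to `r`: it lies
over the midpoint, at distance `h`, to the left (`σ = 1`) or right (`σ = -1`) of the directed
segment. -/
def capVertex (h σ : ℝ) (l r : ℂ) : ℂ :=
  (l + r) / 2 + (σ * (h / ‖r - l‖) : ℝ) * (Complex.I * (r - l))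

/-- The left and right end points of the segment `A_{n,i}`, with `i < 2 ^ n` counted from the left
starting at `0`. The segment `A_{0,0}` is `[(0,0), (1,0)]`, and `A_{n+1,2i}`, `A_{n+1,2i+1}` are the
two shorter sides of the cap over `A_{n,i}`. The first cap points upwards and every later
one points into the cap on whose side it stands (see `cap_subset_cap`); for segments
directed from left to right this means that the sides alternate with the generation. -/
def ends (ε : ℝ) : ℕ → ℕ → ℂ × ℂ
  | 0, _ => (0, 1)
  | n + 1, i =>
    let p := ends ε n (i / 2)
    let a := capVertex (height ε n) ((-1) ^ n) p.1 p.2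
    if i % 2 = 0 then (p.1, a) else (a, p.2)

/-- The new vertex `a_{n,i}` of the cap `T_{n,i}`. -/
def apex (ε : ℝ) (n i : ℕ) : ℂ :=
  capVertex (height ε n) ((-1) ^ n) (ends ε n i).1 (ends ε n i).2

/-- The (closed, filled) triangular cap `T_{n,i}` over `A_{n,i}`. -/
def cap (ε : ℝ) (n i : ℕ) : Set ℂ :=
  convexHull ℝ {(ends ε n i).1, (ends ε n i).2, apex ε n i}

/-- `A_n`, the union of the `2 ^ n` segments `A_{n,i}`. -/
def stage (ε : ℝ) (n : ℕ) : Set ℂ :=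
  ⋃ i ∈ Finset.range (2 ^ n), segment ℝ (ends ε n i).1 (ends ε n i).2

/-- The set `A_ε`. -/
def limitSet (ε : ℝ) : Set ℂ :=
  closure (⋃ n ∈ Ici 1, stage ε n) \ ⋃ n ∈ Ici 1, stage ε n

/-- The base angle `θ_{n,i}` of the cap `T_{n,i}`. -/
def baseAngle (ε : ℝ) (n i : ℕ) : ℝ :=
  EuclideanGeometry.angle (apex ε n i) (ends ε n i).1 (ends ε n i).2

/-- `i(n,x)`: the index of the cap of generation `n` that contains the point `x` (the least such
index, if there are several). -/
def capIndex (ε : ℝ) (x : ℂ) (n : ℕ) : ℕ := sInf {i | i < 2 ^ n ∧ x ∈ cap ε n i}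

/-- The index of the dyadic subinterval `[i / 2 ^ n, (i + 1) / 2 ^ n]` of the base `[0,1]` that
contains `t`. -/
def dyadicIndex (t : ℝ) (n : ℕ) : ℕ := min ⌊2 ^ n * t⌋₊ (2 ^ n - 1)

/-- The partial stretch product, the product of `1 / cos θ_{n,ι(n)}` over `n ≤ N`. -/
def stretch (ε : ℝ) (ι : ℕ → ℕ) (N : ℕ) : ℝ :=
  ∏ n ∈ Finset.range (N + 1), (Real.cos (baseAngle ε n (ι n)))⁻¹

/-- The enumeration `e_1, e_2, …` of all edge points: `e_1 = (0,0)`, `e_2 = (1,0)`, and then the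
`a_{n,i}` generation by generation from left to right. (The value at `0` is not used.) -/
def edgePoint (ε : ℝ) (k : ℕ) : ℂ :=
  if k ≤ 1 then 0 else if k = 2 then 1
  else apex ε (Nat.log 2 (k - 2)) (k - 2 - 2 ^ Nat.log 2 (k - 2))

/-- `ρ_k = 4 ^ (1 - k) * ρ_1`, with `ρ_1 = (1 / 4) * 2 ^ (-7) * (1 + 7 * 16 * ε ^ 2) ^ (1 / 2)`. -/
def rho (ε : ℝ) (k : ℕ) : ℝ :=
  4 / 4 ^ k * (1 / 4 * (1 / 2 ^ 7) * Real.sqrt (1 + 7 * 16 * ε ^ 2))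

/-- The radius `r_k`. For `2 ^ (n + 1) + 1 ≤ k ≤ 2 ^ (n + 2)` it is the minimum of `ρ_k` and half of
the distance of `e_k` from `A_{n-1} ∪ A_{n-2}`, where stages with a negative index are
dropped: for `k ≤ 4` no stage is left, and for `n = 1` the truncated `n - 2` repeats `A_0`. -/
def radius (ε : ℝ) (k : ℕ) : ℝ :=
  if k ≤ 4 then rho ε k
  else
    let n := Nat.log 2 (k - 1) - 1
    min (rho ε k) (Metric.infDist (edgePoint ε k) (stage ε (n - 1) ∪ stage ε (n - 2)) / 2)

/-- The set `𝒜_ε`: the points of `A_ε` outside the open balls of radius `r_k` around `e_k`. -/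
def closedLimitSet (ε : ℝ) : Set ℂ :=
  limitSet ε \ ⋃ k ∈ Ici 1, Metric.ball (edgePoint ε k) (radius ε k)

lemma norm_capVertex_sub {h σ : ℝ} {l r : ℂ} (hσ : σ = 1 ∨ σ = -1) (hlr : l ≠ r) :
    ‖capVertex h σ l r - l‖ ^ 2 = ‖r - l‖ ^ 2 / 4 + h ^ 2 ∧
      ‖r - capVertex h σ l r‖ ^ 2 = ‖r - l‖ ^ 2 / 4 + h ^ 2 := by
  have hw : ‖r - l‖ ≠ 0 := norm_ne_zero_iff.2 (sub_ne_zero.2 hlr.symm)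
  have key : ∀ c : ℝ, c ^ 2 = h ^ 2 / ‖r - l‖ ^ 2 →
      ‖(r - l) * (1 / 2 + c * Complex.I)‖ ^ 2 = ‖r - l‖ ^ 2 / 4 + h ^ 2 := by
    intro c hc
    rw [norm_mul, mul_pow, ← Complex.normSq_eq_norm_sq (1 / 2 + c * Complex.I)]
    have : Complex.normSq (1 / 2 + c * Complex.I) = 1 / 4 + c ^ 2 := by
      simp [Complex.normSq_apply]; ring
    rw [this, hc]; field_simp
  have hs : σ ^ 2 = 1 := by rcases hσ with rfl | rfl <;> norm_num
  constructor
  · rw [← key (σ * (h / ‖r - l‖)) (by rw [mul_pow, hs, div_pow, one_mul])]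
    congr 2; unfold capVertex; push_cast; ring
  · rw [← key (-(σ * (h / ‖r - l‖))) (by rw [neg_sq, mul_pow, hs, div_pow, one_mul])]
    congr 2; unfold capVertex; push_cast; ring

lemma norm_ends (ε : ℝ) (n i : ℕ) :
    ‖(ends ε n i).2 - (ends ε n i).1‖ ^ 2 = (1 + 16 * n * ε ^ 2) / 4 ^ n := by
  induction n generalizing i with
  | zero => simp [ends]
  | succ n ih =>
    have hne : (ends ε n (i / 2)).1 ≠ (ends ε n (i / 2)).2 := by
      intro h
      have h1 := ih (i / 2)
      rw [h, sub_self, norm_zero] at h1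
      have : (0 : ℝ) < (1 + 16 * n * ε ^ 2) / 4 ^ n := by positivity
      linarith
    have hσ : ((-1 : ℝ) ^ n = 1 ∨ (-1 : ℝ) ^ n = -1) := neg_one_pow_eq_or ℝ n
    have hN := norm_capVertex_sub (h := height ε n) hσ hne
    have hv : ((1 + 16 * n * ε ^ 2) / 4 ^ n) / 4 + height ε n ^ 2 =
        (1 + 16 * ((n + 1 : ℕ) : ℝ) * ε ^ 2) / 4 ^ (n + 1) := by
      have h4 : ((2 : ℝ) ^ n) ^ 2 = 4 ^ n := by rw [← pow_mul, mul_comm, pow_mul]; norm_num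
      unfold height
      rw [div_pow, h4]; push_cast; field_simp; ring
    rw [ih, hv] at hN
    simp only [ends]
    split_ifs
    · exact hN.1
    · exact hN.2

lemma capVertex_half_mem {h σ : ℝ} {l r : ℂ} (hσ : σ = 1 ∨ σ = -1) (hlr : l ≠ r)
    (hh : h ^ 2 ≤ ‖r - l‖ ^ 2 / 4) :
    capVertex (h / 2) (-σ) l (capVertex h σ l r) ∈ convexHull ℝ {l, r, capVertex h σ l r} ∧
      capVertex (h / 2) (-σ) (capVertex h σ l r) r ∈ convexHull ℝ {l, r, capVertex h σ l r} := by
  have hs : σ * σ = 1 := by rcases hσ with rfl | rfl <;> norm_num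
  obtain ⟨h1, h2⟩ := norm_capVertex_sub (h := h) hσ hlr
  have hb : 0 < ‖r - l‖ := norm_pos_iff.2 (sub_ne_zero.2 hlr.symm)
  have hcomb : ∀ p q s : ℝ, 0 ≤ p → 0 ≤ q → 0 ≤ s → p + q + s = 1 →
      (p : ℂ) * l + q * r + s * capVertex h σ l r ∈ convexHull ℝ {l, r, capVertex h σ l r} := by
    intro p q s hp hq hs' hsum
    have := (convex_convexHull ℝ ({l, r, capVertex h σ l r} : Set ℂ)).sum_mem
      (t := Finset.univ) (w := ![p, q, s]) (z := ![l, r, capVertex h σ l r])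
      (by intro i _; fin_cases i <;> simpa) (by simpa [Fin.sum_univ_three] using hsum)
      (by intro i _; fin_cases i <;> exact subset_convexHull ℝ _ (by simp))
    simpa [Fin.sum_univ_three] using this
  have hBB : ‖r - capVertex h σ l r‖ = ‖capVertex h σ l r - l‖ :=
    (pow_left_inj₀ (norm_nonneg _) (norm_nonneg _) two_ne_zero).1 (h2.trans h1.symm)
  generalize hBdef : ‖capVertex h σ l r - l‖ = B at h1 hBB
  generalize hbdef : ‖r - l‖ = b at h1 hb hh
  have hB0 : 0 ≤ B := hBdef ▸ norm_nonneg _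
  have hBpos : 0 < B := by
    rcases hB0.lt_or_eq with h' | h'
    · exact h'
    · rw [← h'] at h1; nlinarith [sq_nonneg h, mul_pos hb hb]
  have hBb : B ≤ b := by nlinarith
  have hbB : b / 2 ≤ B := by nlinarith [sq_nonneg h]
  have hq : 0 ≤ B / (2 * b) := by positivity
  have hq' : B / (2 * b) ≤ 1 / 2 := by rw [div_le_div_iff₀ (by positivity) two_pos]; linarith
  have hp : 0 ≤ b / (4 * B) := by positivity
  have hp' : b / (4 * B) ≤ 1 / 2 := by rw [div_le_div_iff₀ (by positivity) two_pos]; linarith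
  have hbC : (b : ℂ) ≠ 0 := by exact_mod_cast hb.ne'
  have hBC : (B : ℂ) ≠ 0 := by exact_mod_cast hBpos.ne'
  have hsC : (σ : ℂ) * σ = 1 := by exact_mod_cast hs
  have h1C : (h : ℂ) ^ 2 = B ^ 2 - b ^ 2 / 4 := by
    have : h ^ 2 = B ^ 2 - b ^ 2 / 4 := by linarith
    exact_mod_cast this
  constructor
  · convert hcomb (1 / 2 + b / (4 * B) - B / (2 * b)) (B / (2 * b)) (1 / 2 - b / (4 * B))
      (by linarith) hq (by linarith) (by ring) using 1
    rw [capVertex, hBdef, capVertex, hbdef]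
    push_cast
    field_simp
    linear_combination (norm := ring_nf) 8 * (l - r) * (h ^ 2 * σ ^ 2 * Complex.I_sq - h ^ 2 * hsC - h1C)
  · convert hcomb (B / (2 * b)) (1 / 2 + b / (4 * B) - B / (2 * b)) (1 / 2 - b / (4 * B))
      hq (by linarith) (by linarith) (by ring) using 1
    rw [capVertex, hBB, capVertex, hbdef]
    push_cast
    field_simp
    linear_combination (norm := ring_nf) 8 * (r - l) * (h ^ 2 * σ ^ 2 * Complex.I_sq - h ^ 2 * hsC - h1C)

/-- The choice of sides in `ends` is the intended one: each cap of generation `n + 1` lies in the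
cap of generation `n` on whose side it stands. -/
lemma cap_subset_cap {ε : ℝ} (hε : 0 < ε) (hε' : ε < 1 / 8) (n i : ℕ) :
    cap ε (n + 1) i ⊆ cap ε n (i / 2) := by
  have hb2 := norm_ends ε n (i / 2)
  have hσ : ((-1 : ℝ) ^ n = 1 ∨ (-1 : ℝ) ^ n = -1) := neg_one_pow_eq_or ℝ n
  have hne : (ends ε n (i / 2)).1 ≠ (ends ε n (i / 2)).2 := by
    intro h
    rw [h, sub_self, norm_zero] at hb2
    have : (0 : ℝ) < (1 + 16 * n * ε ^ 2) / 4 ^ n := by positivity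
    linarith
  have hh2 : height ε n ^ 2 ≤ ‖(ends ε n (i / 2)).2 - (ends ε n (i / 2)).1‖ ^ 2 / 4 := by
    have h4 : ((2 : ℝ) ^ n) ^ 2 = 4 ^ n := by rw [← pow_mul, mul_comm, pow_mul]; norm_num
    rw [hb2, height, div_pow, h4, div_right_comm]
    gcongr
    have : (0 : ℝ) ≤ 16 * n * ε ^ 2 := by positivity
    nlinarith
  have hhn : height ε (n + 1) = height ε n / 2 := by unfold height; rw [pow_succ]; field_simp
  obtain ⟨hL, hR⟩ := capVertex_half_mem hσ hne hh2
  have hl : (ends ε n (i / 2)).1 ∈ cap ε n (i / 2) := subset_convexHull ℝ _ (by simp)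
  have hr : (ends ε n (i / 2)).2 ∈ cap ε n (i / 2) := subset_convexHull ℝ _ (by simp)
  have ha : apex ε n (i / 2) ∈ cap ε n (i / 2) := subset_convexHull ℝ _ (by simp)
  refine convexHull_min ?_ (convex_convexHull ℝ _)
  have hsg : (-1 : ℝ) ^ (n + 1) = -(-1) ^ n := by ring
  rcases Nat.mod_two_eq_zero_or_one i with hi | hi
  · have he : ends ε (n + 1) i = ((ends ε n (i / 2)).1, apex ε n (i / 2)) := by
      simp [ends, apex, hi]
    rintro x (rfl | rfl | rfl)
    · rw [he]; exact hl
    · rw [he]; exact ha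
    · rw [apex, he, hhn, hsg]; exact hL
  · have he : ends ε (n + 1) i = (apex ε n (i / 2), (ends ε n (i / 2)).2) := by
      simp [ends, apex, hi]
    rintro x (rfl | rfl | rfl)
    · rw [he]; exact ha
    · rw [he]; exact hr
    · rw [apex, he, hhn, hsg]; exact hR

end

end Koch

/-!
The segments of generation `n` all have length `b_n = 2 ^ (-n) L_n` with `L_n = √(1 + 16 n ε²)`, so
every stretch product telescopes to some `L_n`, and `L_n → ∞` (`stretch_eq`).

The plane geometry rests on widened caps (`region`): at both ends of the base the angular sector of
a cap is enlarged on either side by a fixed angle. Because the caps alternate sides, the widened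
caps over the two sides of a cap lie in the widened cap over its base, and they are separated by its
perpendicular bisector. By induction two widened caps of the same generation meet at most in end
points of their bases (`eq_end_of_mem_region`). This gives uniqueness of the cap containing a
point of `A_ε`, and it shows that the only points of the stages that are limits of points of `A_ε`
are edge points. The radii `r_k` are positive, so removing the balls leaves a closed set.

For the failure of rectifiability, let `μ` be the image of Lebesgue measure on `[0, 1)` under the
natural parametrization, so that each cap of generation `n` receives mass `2 ^ (-n)`. Since the
widening angle does not depend on `n`, a widened cap contains a disc of radius `b_n / 5`; comparing
areas, a ball of radius `r ≈ b_n` meets a bounded number of caps of generation `n`. Therefore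
`μ (B_r) ≤ C 2 ^ (-n) ≤ 75 r / L_n` (`naturalMeasure_closedBall_le`). As `L_n → ∞`, the measure `μ`
is dominated by `κ • μH[1]` for every `κ > 0`, so it vanishes on all sets of finite length, hence on
all countably 1-rectifiable sets and on all stages. On the other hand `μ` is a probability measure
carried by `A_ε`, and the removed balls have total measure at most `75 ∑ ρ_k < 1`. So the closed
set that remains has positive `μ`-measure and is not countably 1-rectifiable.
-/

namespace Koch

/-! ### Lengths and slopes -/

/-- The total length `√(1 + 16 n ε²)` of the path of generation `n`. -/
noncomputable def totalLength (ε : ℝ) (n : ℕ) : ℝ := √(1 + 16 * n * ε ^ 2)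

/-- The common length of the `2 ^ n` segments of generation `n`. -/
noncomputable def sideLength (ε : ℝ) (n : ℕ) : ℝ := totalLength ε n / 2 ^ n

/-- The tangent of the base angle of the caps of generation `n`. -/
noncomputable def slope (ε : ℝ) (n : ℕ) : ℝ := 4 * ε / totalLength ε n

lemma totalLength_sq (ε : ℝ) (n : ℕ) : totalLength ε n ^ 2 = 1 + 16 * n * ε ^ 2 :=
  Real.sq_sqrt (by positivity)

lemma one_le_totalLength (ε : ℝ) (n : ℕ) : 1 ≤ totalLength ε n :=
  Real.one_le_sqrt.2 (by have : (0 : ℝ) ≤ 16 * n * ε ^ 2 := by positivity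
                         linarith)

lemma totalLength_pos (ε : ℝ) (n : ℕ) : 0 < totalLength ε n :=
  zero_lt_one.trans_le (one_le_totalLength ε n)

lemma totalLength_mono (ε : ℝ) : Monotone (totalLength ε) := fun m n h ↦ by
  unfold totalLength; gcongr

lemma totalLength_lt_succ {ε : ℝ} (hε : 0 < ε) (n : ℕ) :
    totalLength ε n < totalLength ε (n + 1) := by
  refine Real.sqrt_lt_sqrt (by positivity) ?_
  push_cast; nlinarith [pow_pos hε 2]

lemma tendsto_totalLength {ε : ℝ} (hε : 0 < ε) : Tendsto (totalLength ε) atTop atTop := by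
  refine Real.tendsto_sqrt_atTop.comp (tendsto_atTop_add_const_left _ 1 ?_)
  have h : (0 : ℝ) < 16 * ε ^ 2 := by positivity
  convert (tendsto_natCast_atTop_atTop (R := ℝ)).atTop_mul_const h using 2
  ring

lemma sideLength_pos (ε : ℝ) (n : ℕ) : 0 < sideLength ε n :=
  div_pos (totalLength_pos ε n) (by positivity)

lemma norm_side (ε : ℝ) (n i : ℕ) :
    ‖(ends ε n i).2 - (ends ε n i).1‖ = sideLength ε n := by
  refine (pow_left_inj₀ (norm_nonneg _) (sideLength_pos ε n).le two_ne_zero).1 ?_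
  have h4 : ((2 : ℝ) ^ n) ^ 2 = 4 ^ n := by rw [← pow_mul, mul_comm, pow_mul]; norm_num
  rw [norm_ends, sideLength, div_pow, totalLength_sq, h4]

lemma side_ne_zero (ε : ℝ) (n i : ℕ) : (ends ε n i).2 - (ends ε n i).1 ≠ 0 :=
  norm_pos_iff.1 (by rw [norm_side]; exact sideLength_pos ε n)

lemma slope_pos {ε : ℝ} (hε : 0 < ε) (n : ℕ) : 0 < slope ε n :=
  div_pos (by linarith) (totalLength_pos ε n)

lemma slope_lt_half {ε : ℝ} (hε' : ε < 1 / 8) (n : ℕ) : slope ε n < 1 / 2 := by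
  rw [slope, div_lt_iff₀ (totalLength_pos ε n)]
  linarith [one_le_totalLength ε n]

lemma slope_succ_lt {ε : ℝ} (hε : 0 < ε) (n : ℕ) : slope ε (n + 1) < slope ε n :=
  div_lt_div_of_pos_left (by linarith) (totalLength_pos ε n) (totalLength_lt_succ hε n)

lemma half_sideLength_lt_succ {ε : ℝ} (hε : 0 < ε) (n : ℕ) :
    sideLength ε n / 2 < sideLength ε (n + 1) := by
  rw [sideLength, sideLength, pow_succ, div_div]
  gcongr
  exact totalLength_lt_succ hε n

lemma tendsto_sideLength {ε : ℝ} (hε : 0 < ε) (hε' : ε < 1 / 8) :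
    Tendsto (sideLength ε) atTop (𝓝 0) := by
  have h : Tendsto (fun n ↦ sideLength ε n ^ 2) atTop (𝓝 0) := by
    refine squeeze_zero (fun n ↦ sq_nonneg _) (fun n ↦ ?_)
      (tendsto_pow_atTop_nhds_zero_of_lt_one (r := (1 / 2 : ℝ)) (by norm_num) (by norm_num))
    have h1 : (n : ℝ) + 1 ≤ 2 ^ n := by exact_mod_cast Nat.lt_two_pow_self
    have h2 : 1 + 16 * n * ε ^ 2 ≤ (2 : ℝ) ^ n := by
      have : ε ^ 2 ≤ 1 / 64 := by nlinarith [hε, hε']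
      nlinarith [(Nat.cast_nonneg n : (0 : ℝ) ≤ n)]
    rw [sideLength, div_pow, totalLength_sq, one_div, inv_pow, div_le_iff₀ (by positivity),
      pow_two (2 ^ n : ℝ), inv_mul_cancel_left₀ (by positivity)]
    exact h2
  have := (Real.continuous_sqrt.tendsto _).comp h
  simpa [Function.comp_def, Real.sqrt_sq (sideLength_pos ε _).le] using this

lemma ends_zero (ε : ℝ) (i : ℕ) : ends ε 0 i = (0, 1) := rfl

lemma ends_left (ε : ℝ) (n j : ℕ) : ends ε (n + 1) (2 * j) = ((ends ε n j).1, apex ε n j) := by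
  simp [ends, apex]

lemma ends_right (ε : ℝ) (n j : ℕ) :
    ends ε (n + 1) (2 * j + 1) = (apex ε n j, (ends ε n j).2) := by
  have : (2 * j + 1) / 2 = j := by lia
  simp [ends, apex, this, Nat.add_mod]

lemma apex_eq (ε : ℝ) (n i : ℕ) : apex ε n i = (ends ε n i).1 +
    ((ends ε n i).2 - (ends ε n i).1) * ⟨1 / 2, (-1) ^ n * (slope ε n / 2)⟩ := by
  have h : height ε n / sideLength ε n = slope ε n / 2 := by
    have := (totalLength_pos ε n).ne'
    rw [height, sideLength, slope]; field_simp; ring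
  rw [apex, capVertex, norm_side, h, Complex.mk_eq_add_mul_I]
  push_cast
  ring

/-! ### Coordinates adapted to a segment -/

/-- Coordinates in which the segment `A_{n,i}` becomes the segment from `0` to `1` of the real axis
and its cap points upwards. The map is a similarity, orientation reversing for odd `n`. -/
noncomputable def coord (ε : ℝ) (n i : ℕ) (z : ℂ) : ℂ :=
  ⟨((z - (ends ε n i).1) / ((ends ε n i).2 - (ends ε n i).1)).re,
    (-1) ^ n * ((z - (ends ε n i).1) / ((ends ε n i).2 - (ends ε n i).1)).im⟩

lemma coord_left_end (ε : ℝ) (n i : ℕ) : coord ε n i (ends ε n i).1 = 0 := by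
  simp [coord, Complex.ext_iff]

lemma coord_right_end (ε : ℝ) (n i : ℕ) : coord ε n i (ends ε n i).2 = 1 := by
  simp [coord, Complex.ext_iff, div_self (side_ne_zero ε n i)]

lemma coord_apex (ε : ℝ) (n i : ℕ) : coord ε n i (apex ε n i) = ⟨1 / 2, slope ε n / 2⟩ := by
  rw [coord, apex_eq, add_sub_cancel_left, mul_div_cancel_left₀ _ (side_ne_zero ε n i)]
  simp [← mul_assoc, ← mul_pow]

lemma neg_one_pow_sq (n : ℕ) : ((-1 : ℝ) ^ n) ^ 2 = 1 := by simp [← pow_mul, mul_comm n 2]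

lemma norm_sub_eq_sideLength_mul (ε : ℝ) (n i : ℕ) (x y : ℂ) :
    ‖x - y‖ = sideLength ε n * ‖coord ε n i x - coord ε n i y‖ := by
  have h : ‖coord ε n i x - coord ε n i y‖ =
      ‖(x - y) / ((ends ε n i).2 - (ends ε n i).1)‖ := by
    refine (pow_left_inj₀ (norm_nonneg _) (norm_nonneg _) two_ne_zero).1 ?_
    rw [← sub_sub_sub_cancel_right x y (ends ε n i).1, sub_div, Complex.sq_norm, Complex.sq_norm,
      Complex.normSq_apply, Complex.normSq_apply]
    simp only [coord, Complex.sub_re, Complex.sub_im]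
    linear_combination (((x - (ends ε n i).1) / ((ends ε n i).2 - (ends ε n i).1)).im -
      ((y - (ends ε n i).1) / ((ends ε n i).2 - (ends ε n i).1)).im) ^ 2 * neg_one_pow_sq n
  rw [h, norm_div, norm_side, mul_div_cancel₀ _ (sideLength_pos ε n).ne']

lemma coord_injective (ε : ℝ) (n i : ℕ) : Function.Injective (coord ε n i) := fun x y h ↦ by
  have := norm_sub_eq_sideLength_mul ε n i x y
  rwa [h, sub_self, norm_zero, mul_zero, norm_eq_zero, sub_eq_zero] at this

lemma coord_combo (ε : ℝ) (n i : ℕ) (x y : ℂ) {a b : ℝ} (hab : a + b = 1) :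
    coord ε n i (a • x + b • y) = a • coord ε n i x + b • coord ε n i y := by
  have h : (a • x + b • y - (ends ε n i).1) / ((ends ε n i).2 - (ends ε n i).1) =
      a • ((x - (ends ε n i).1) / ((ends ε n i).2 - (ends ε n i).1)) +
      b • ((y - (ends ε n i).1) / ((ends ε n i).2 - (ends ε n i).1)) := by
    have : (b : ℂ) = 1 - a := by rw [← Complex.ofReal_one, ← hab]; push_cast; ring
    simp only [Complex.real_smul, this]
    ring
  rw [coord, h]
  apply Complex.ext <;> simp [coord]
  ring

lemma convex_preimage_coord (ε : ℝ) (n i : ℕ) {K : Set ℂ} (hK : Convex ℝ K) :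
    Convex ℝ (coord ε n i ⁻¹' K) := fun x hx y hy a b ha hb hab ↦ by
  rw [mem_preimage, coord_combo ε n i x y hab]
  exact hK hx hy ha hb hab

/-- The coordinates with respect to a segment in terms of those with respect to the left one of the
two sides standing on it. -/
lemma coord_of_left (ε : ℝ) (n j : ℕ) (z : ℂ) : coord ε n j z =
    ⟨((coord ε (n + 1) (2 * j) z).re + slope ε n * (coord ε (n + 1) (2 * j) z).im) / 2,
      (slope ε n * (coord ε (n + 1) (2 * j) z).re - (coord ε (n + 1) (2 * j) z).im) / 2⟩ := by
  have hd := side_ne_zero ε n j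
  have hd' := side_ne_zero ε (n + 1) (2 * j)
  have hc : (⟨1 / 2, (-1) ^ n * (slope ε n / 2)⟩ : ℂ) ≠ 0 := by simp [Complex.ext_iff]
  have h : (z - (ends ε n j).1) / ((ends ε n j).2 - (ends ε n j).1) =
      (z - (ends ε (n + 1) (2 * j)).1) /
        ((ends ε (n + 1) (2 * j)).2 - (ends ε (n + 1) (2 * j)).1) *
        ⟨1 / 2, (-1) ^ n * (slope ε n / 2)⟩ := by
    rw [ends_left, apex_eq]
    simp only [add_sub_cancel_left]
    generalize (⟨1 / 2, (-1) ^ n * (slope ε n / 2)⟩ : ℂ) = c at hc ⊢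
    field_simp
  rw [coord, h]
  apply Complex.ext
  · simp only [coord, Complex.mul_re, pow_succ]; ring
  · simp only [coord, Complex.mul_im, pow_succ]
    linear_combination ((z - (ends ε (n + 1) (2 * j)).1) /
        ((ends ε (n + 1) (2 * j)).2 - (ends ε (n + 1) (2 * j)).1)).re * slope ε n / 2 *
        neg_one_pow_sq n

/-- The coordinates with respect to a segment in terms of those with respect to the right one of the
two sides standing on it. -/
lemma coord_of_right (ε : ℝ) (n j : ℕ) (z : ℂ) : coord ε n j z =
    ⟨1 - ((1 - (coord ε (n + 1) (2 * j + 1) z).re) +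
        slope ε n * (coord ε (n + 1) (2 * j + 1) z).im) / 2,
      (slope ε n * (1 - (coord ε (n + 1) (2 * j + 1) z).re) -
        (coord ε (n + 1) (2 * j + 1) z).im) / 2⟩ := by
  have hd := side_ne_zero ε n j
  have hc : (⟨1 / 2, -((-1) ^ n * (slope ε n / 2))⟩ : ℂ) ≠ 0 := by simp [Complex.ext_iff]
  have hcc : (1 : ℂ) - ⟨1 / 2, (-1) ^ n * (slope ε n / 2)⟩ =
      ⟨1 / 2, -((-1) ^ n * (slope ε n / 2))⟩ := by
    apply Complex.ext <;> simp; norm_num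
  have hs : (ends ε n j).2 - apex ε n j = ((ends ε n j).2 - (ends ε n j).1) *
      ⟨1 / 2, -((-1) ^ n * (slope ε n / 2))⟩ := by
    rw [apex_eq, ← hcc]; ring
  have h : (z - (ends ε n j).1) / ((ends ε n j).2 - (ends ε n j).1) =
      1 - (1 - (z - (ends ε (n + 1) (2 * j + 1)).1) /
        ((ends ε (n + 1) (2 * j + 1)).2 - (ends ε (n + 1) (2 * j + 1)).1)) *
        ⟨1 / 2, -((-1) ^ n * (slope ε n / 2))⟩ := by
    rw [ends_right]
    simp only [hs]
    have : z - apex ε n j = (z - (ends ε n j).1) - ((ends ε n j).2 - (ends ε n j).1) *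
      ⟨1 / 2, (-1) ^ n * (slope ε n / 2)⟩ := by rw [apex_eq]; ring
    rw [this]
    generalize (⟨1 / 2, (-1) ^ n * (slope ε n / 2)⟩ : ℂ) = c at hcc ⊢
    rw [← hcc] at hc ⊢
    field_simp
    ring
  rw [coord, h]
  apply Complex.ext
  · simp only [coord, Complex.mul_re, Complex.sub_re, Complex.one_re, Complex.sub_im,
      Complex.one_im, pow_succ]
    ring
  · simp only [coord, Complex.mul_im, Complex.sub_re, Complex.one_re, Complex.sub_im,
      Complex.one_im, pow_succ]
    linear_combination (1 - ((z - (ends ε (n + 1) (2 * j + 1)).1) /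
        ((ends ε (n + 1) (2 * j + 1)).2 - (ends ε (n + 1) (2 * j + 1)).1)).re) * slope ε n / 2 *
        neg_one_pow_sq n

/-! ### The stretch product -/

lemma cos_baseAngle (ε : ℝ) (n i : ℕ) :
    (Real.cos (baseAngle ε n i))⁻¹ = totalLength ε (n + 1) / totalLength ε n := by
  have h1 : ‖apex ε n i - (ends ε n i).1‖ = sideLength ε (n + 1) := by
    have := norm_side ε (n + 1) (2 * i)
    rwa [ends_left] at this
  have h2 : inner ℝ (apex ε n i - (ends ε n i).1) ((ends ε n i).2 - (ends ε n i).1) =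
      sideLength ε n ^ 2 / 2 := by
    rw [apex_eq, add_sub_cancel_left, ← norm_side ε n i, Complex.sq_norm, Complex.normSq_apply,
      Complex.inner]
    simp; ring
  rw [baseAngle, EuclideanGeometry.angle, vsub_eq_sub, vsub_eq_sub, InnerProductGeometry.cos_angle,
    h1, h2, norm_side, sideLength, sideLength]
  have := totalLength_pos ε n
  have := totalLength_pos ε (n + 1)
  field_simp
  ring

/-- The stretch product telescopes: it is the total length of a generation, whatever caps are
chosen. -/
lemma stretch_eq (ε : ℝ) (ι : ℕ → ℕ) (N : ℕ) : stretch ε ι N = totalLength ε (N + 1) := by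
  have h0 : totalLength ε 0 = 1 := by simp [totalLength]
  rw [stretch]
  simp only [cos_baseAngle]
  induction N with
  | zero => simp [h0]
  | succ N ih =>
    rw [Finset.prod_range_succ, ih, mul_div_cancel₀ _ (totalLength_pos ε (N + 1)).ne']

lemma tendsto_stretch {ε : ℝ} (hε : 0 < ε) (ι : ℕ → ℕ) : Tendsto (stretch ε ι) atTop atTop := by
  simp only [funext (stretch_eq ε ι)]
  exact (tendsto_add_atTop_iff_nat 1).2 (tendsto_totalLength hε)

/-! ### Kites -/

/-- The quadrilateral with diagonal from `0` to `1` whose sides have slopes `± H` above and `± s`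
below the diagonal. -/
def kite (H s : ℝ) : Set ℂ :=
  {w | w.im ≤ H * w.re ∧ w.im ≤ H * (1 - w.re) ∧ -w.im ≤ s * w.re ∧ -w.im ≤ s * (1 - w.re)}

lemma convex_kite (H s : ℝ) : Convex ℝ (kite H s) := by
  rintro x ⟨hx1, hx2, hx3, hx4⟩ y ⟨hy1, hy2, hy3, hy4⟩ a b ha hb hab
  obtain rfl : b = 1 - a := by linarith
  simp only [kite, mem_ofPred_eq, Complex.add_re, Complex.add_im, Complex.real_smul,
    Complex.re_ofReal_mul, Complex.im_ofReal_mul]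
  refine ⟨?_, ?_, ?_, ?_⟩
  · linarith [mul_le_mul_of_nonneg_left hx1 ha, mul_le_mul_of_nonneg_left hy1 hb]
  · linarith [mul_le_mul_of_nonneg_left hx2 ha, mul_le_mul_of_nonneg_left hy2 hb]
  · linarith [mul_le_mul_of_nonneg_left hx3 ha, mul_le_mul_of_nonneg_left hy3 hb]
  · linarith [mul_le_mul_of_nonneg_left hx4 ha, mul_le_mul_of_nonneg_left hy4 hb]

lemma mirror_mem_kite {H s : ℝ} {w : ℂ} (h : w ∈ kite H s) : (⟨1 - w.re, w.im⟩ : ℂ) ∈ kite H s := by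
  obtain ⟨h1, h2, h3, h4⟩ := h
  exact ⟨h2, by simpa using h1, h4, by simpa using h3⟩

lemma re_mem_Icc_of_mem_kite {H s : ℝ} (hHs : 0 < H + s) {w : ℂ}
    (h : w ∈ kite H s) : w.re ∈ Icc 0 1 := by
  obtain ⟨h1, h2, h3, h4⟩ := h
  constructor <;> nlinarith [hHs]

lemma kite_subset_kite {H H' s s' : ℝ} (hH : 0 < H) (hs : 0 ≤ s) (hHH : H ≤ H') (hss : s ≤ s') :
    kite H s ⊆ kite H' s' := by
  intro w h
  obtain ⟨hr0, hr1⟩ := re_mem_Icc_of_mem_kite (by linarith) h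
  obtain ⟨h1, h2, h3, h4⟩ := h
  have hr1' : 0 ≤ 1 - w.re := by linarith
  exact ⟨h1.trans (by gcongr), h2.trans (by gcongr), h3.trans (by gcongr), h4.trans (by gcongr)⟩

/-- The slope belonging to the sum of the angles with slopes `τ` and `1 / 2`. -/
noncomputable def widen (τ : ℝ) : ℝ := (1 / 2 + τ) / (1 - τ / 2)

lemma widen_mul {τ : ℝ} (h : τ < 1 / 2) : widen τ * (1 - τ / 2) = 1 / 2 + τ :=
  div_mul_cancel₀ _ (by linarith)

lemma half_le_widen {τ : ℝ} (h0 : 0 < τ) (h : τ < 1 / 2) : 1 / 2 + τ ≤ widen τ := by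
  rw [widen, le_div_iff₀ (by linarith)]; nlinarith

lemma widen_le {τ : ℝ} (h0 : 0 < τ) (h : τ < 1 / 2) : widen τ ≤ 4 / 3 := by
  rw [widen, div_le_iff₀ (by linarith)]; linarith

lemma widen_mono {σ τ : ℝ} (h0 : 0 < σ) (hστ : σ < τ) (h : τ < 1 / 2) : widen σ ≤ widen τ := by
  unfold widen
  have : 0 < 1 - τ / 2 := by linarith
  have : 0 ≤ 1 / 2 + τ := by linarith
  gcongr

/-- The kite over the left side of a cap of slope `τ` lies in the kite over the base, and in its
left half. The angles match exactly at the common left end: the angle of slope `1 / 2` added above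
the small kite is the one added below the base, and conversely. -/
lemma left_mem_kite {σ τ : ℝ} (h0 : 0 < σ) (hστ : σ < τ) (h : τ < 1 / 2) {w : ℂ}
    (hw : w ∈ kite (widen σ) (1 / 2)) :
    (⟨(w.re + τ * w.im) / 2, (τ * w.re - w.im) / 2⟩ : ℂ) ∈ kite (widen τ) (1 / 2) ∧
      (w.re + τ * w.im) / 2 ≤ 1 / 2 ∧ ((w.re + τ * w.im) / 2 = 1 / 2 → w = 1) := by
  have hm := widen_mul h
  have hH := half_le_widen (h0.trans hστ) h
  have hH2 := widen_le (h0.trans hστ) h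
  have hσ := widen_mono h0 hστ h
  have hσ0 := half_le_widen h0 (hστ.trans h)
  obtain ⟨hr0, hr1⟩ := re_mem_Icc_of_mem_kite (by linarith) hw
  obtain ⟨h1, h2, h3, h4⟩ := kite_subset_kite (by linarith) (by norm_num) hσ le_rfl hw
  have hτ0 : 0 < τ := h0.trans hστ
  generalize widen τ = H at *
  have hd : w.im * τ ≤ 2 / 3 * (1 - w.re) := by nlinarith
  have hre : w = 1 ↔ w.re = 1 ∧ w.im = 0 := by simp [Complex.ext_iff]
  refine ⟨⟨?_, ?_, ?_, ?_⟩, by linarith, fun heq ↦ ?_⟩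
  · show (τ * w.re - w.im) / 2 ≤ H * ((w.re + τ * w.im) / 2)
    nlinarith [mul_le_mul_of_nonneg_right h3 (by nlinarith : 0 ≤ 1 + H * τ)]
  · show (τ * w.re - w.im) / 2 ≤ H * (1 - (w.re + τ * w.im) / 2)
    have : 0 ≤ 1 - H * τ := by nlinarith
    nlinarith [mul_le_mul_of_nonneg_right h4 this]
  · show -((τ * w.re - w.im) / 2) ≤ 1 / 2 * ((w.re + τ * w.im) / 2)
    nlinarith [mul_le_mul_of_nonneg_right h1 (by linarith : 0 ≤ 1 - τ / 2)]
  · show -((τ * w.re - w.im) / 2) ≤ 1 / 2 * (1 - (w.re + τ * w.im) / 2)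
    nlinarith [mul_le_mul_of_nonneg_right h1 (by linarith : 0 ≤ 1 + τ / 2),
      mul_le_mul_of_nonneg_right h2 (by linarith : 0 ≤ 1 + τ / 2)]
  · have h1' : w.re = 1 := by linarith
    rw [h1'] at h2 h4
    exact hre.2 ⟨h1', by linarith⟩

/-! ### Widened caps meet only at end points -/

/-- The cap `T_{n,i}` widened at both ends of its base by the angle of slope `1 / 2`, both beyond
the cap and below the base. -/
def region (ε : ℝ) (n i : ℕ) : Set ℂ := coord ε n i ⁻¹' kite (widen (slope ε n)) (1 / 2)

lemma coord_mem_kite_of_mem_cap {ε : ℝ} (hε : 0 < ε) {n i : ℕ} {z : ℂ} (hz : z ∈ cap ε n i) :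
    coord ε n i z ∈ kite (slope ε n) 0 := by
  have hs := slope_pos hε n
  refine convexHull_min ?_ (convex_preimage_coord ε n i (convex_kite _ _)) hz
  rintro x (rfl | rfl | rfl) <;> rw [mem_preimage]
  · rw [coord_left_end]; simp [kite, hs.le]
  · rw [coord_right_end]; simp [kite, hs.le]
  · rw [coord_apex]; simp only [kite, mem_ofPred_eq]; refine ⟨?_, ?_, ?_, ?_⟩ <;> linarith

lemma cap_subset_region {ε : ℝ} (hε : 0 < ε) (hε' : ε < 1 / 8) (n i : ℕ) :
    cap ε n i ⊆ region ε n i := fun z hz ↦ by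
  have hs := slope_pos hε n
  have := half_le_widen hs (slope_lt_half hε' n)
  exact kite_subset_kite hs le_rfl (by linarith) (by norm_num) (coord_mem_kite_of_mem_cap hε hz)

lemma mem_region_of_left {ε : ℝ} (hε : 0 < ε) (hε' : ε < 1 / 8) {n j : ℕ} {z : ℂ}
    (hz : z ∈ region ε (n + 1) (2 * j)) :
    z ∈ region ε n j ∧ (coord ε n j z).re ≤ 1 / 2 ∧
      ((coord ε n j z).re = 1 / 2 → z = apex ε n j) := by
  have h := left_mem_kite (slope_pos hε (n + 1)) (slope_succ_lt hε n) (slope_lt_half hε' n) hz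
  rw [← coord_of_left] at h
  refine ⟨h.1, by simpa [coord_of_left ε n j z] using h.2.1, fun he ↦ ?_⟩
  refine coord_injective ε (n + 1) (2 * j) ?_
  have : apex ε n j = (ends ε (n + 1) (2 * j)).2 := by rw [ends_left]
  rw [this, coord_right_end]
  exact h.2.2 (by simpa [coord_of_left ε n j z] using he)

lemma mem_region_of_right {ε : ℝ} (hε : 0 < ε) (hε' : ε < 1 / 8) {n j : ℕ} {z : ℂ}
    (hz : z ∈ region ε (n + 1) (2 * j + 1)) :
    z ∈ region ε n j ∧ 1 / 2 ≤ (coord ε n j z).re ∧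
      ((coord ε n j z).re = 1 / 2 → z = apex ε n j) := by
  obtain ⟨h1, h2, h3⟩ := left_mem_kite (slope_pos hε (n + 1)) (slope_succ_lt hε n)
    (slope_lt_half hε' n) (mirror_mem_kite hz)
  have hre : (coord ε n j z).re = 1 - ((1 - (coord ε (n + 1) (2 * j + 1) z).re) +
        slope ε n * (coord ε (n + 1) (2 * j + 1) z).im) / 2 := by rw [coord_of_right]
  refine ⟨?_, by rw [hre]; linarith, fun he ↦ ?_⟩
  · rw [region, mem_preimage, coord_of_right]
    exact mirror_mem_kite h1
  · refine coord_injective ε (n + 1) (2 * j + 1) ?_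
    have : apex ε n j = (ends ε (n + 1) (2 * j + 1)).1 := by rw [ends_right]
    rw [this, coord_left_end]
    have h4 := Complex.ext_iff.1 (h3 (by linarith))
    simp only [Complex.one_re, Complex.one_im] at h4
    exact Complex.ext (by simpa using h4.1) h4.2

/-- Different widened caps of the same generation meet at most at end points of their bases. -/
lemma eq_end_of_mem_region {ε : ℝ} (hε : 0 < ε) (hε' : ε < 1 / 8) {n i j : ℕ} {z : ℂ}
    (hi : i < 2 ^ n) (hj : j < 2 ^ n) (hij : i ≠ j)
    (hzi : z ∈ region ε n i) (hzj : z ∈ region ε n j) :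
    z = (ends ε n i).1 ∨ z = (ends ε n i).2 := by
  induction n generalizing i j with
  | zero => simp at hi hj; lia
  | succ n ih =>
    rw [pow_succ] at hi hj
    obtain ⟨p, rfl | rfl⟩ := i.even_or_odd'
    · obtain ⟨hp, hle, he⟩ := mem_region_of_left hε hε' hzi
      rw [ends_left]
      obtain ⟨q, rfl | rfl⟩ := j.even_or_odd'
      · obtain ⟨hq, -⟩ := mem_region_of_left hε hε' hzj
        rcases ih (by lia) (by lia) (by lia) hp hq with h | h
        · exact .inl h
        · rw [h, coord_right_end] at hle; norm_num at hle
      · obtain ⟨hq, hle', -⟩ := mem_region_of_right hε hε' hzj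
        rcases eq_or_ne p q with rfl | hpq
        · exact .inr (he (hle.antisymm hle'))
        rcases ih (by lia) (by lia) hpq hp hq with h | h
        · exact .inl h
        · rw [h, coord_right_end] at hle; norm_num at hle
    · obtain ⟨hp, hle, he⟩ := mem_region_of_right hε hε' hzi
      rw [ends_right]
      obtain ⟨q, rfl | rfl⟩ := j.even_or_odd'
      · obtain ⟨hq, hle', -⟩ := mem_region_of_left hε hε' hzj
        rcases eq_or_ne p q with rfl | hpq
        · exact .inl (he (hle'.antisymm hle))
        rcases ih (by lia) (by lia) hpq hp hq with h | h
        · rw [h, coord_left_end] at hle; norm_num at hle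
        · exact .inr h
      · obtain ⟨hq, -⟩ := mem_region_of_right hε hε' hzj
        rcases ih (by lia) (by lia) (by lia) hp hq with h | h
        · rw [h, coord_left_end] at hle; norm_num at hle
        · exact .inr h

lemma segment_subset_cap (ε : ℝ) (n i : ℕ) :
    segment ℝ (ends ε n i).1 (ends ε n i).2 ⊆ cap ε n i :=
  segment_subset_convexHull (by simp) (by simp)

lemma coord_im_of_mem_segment {ε : ℝ} {n i : ℕ} {z : ℂ}
    (hz : z ∈ segment ℝ (ends ε n i).1 (ends ε n i).2) : (coord ε n i z).im = 0 := by
  obtain ⟨a, b, -, -, hab, rfl⟩ := hz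
  rw [coord_combo ε n i _ _ hab, coord_left_end, coord_right_end]
  simp

/-- A cap meets the segments of the preceding generation at most in their end points. -/
lemma eq_end_of_mem_cap_of_mem_segment {ε : ℝ} (hε : 0 < ε) (hε' : ε < 1 / 8) {n i j : ℕ} {z : ℂ}
    (hi : i < 2 ^ n) (hj : j < 2 ^ (n + 1))
    (hzj : z ∈ cap ε (n + 1) j) (hzi : z ∈ segment ℝ (ends ε n i).1 (ends ε n i).2) :
    z = (ends ε n i).1 ∨ z = (ends ε n i).2 := by
  rw [pow_succ] at hj
  rcases eq_or_ne i (j / 2) with rfl | hij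
  · have him := coord_im_of_mem_segment hzi
    have h := coord_mem_kite_of_mem_cap hε hzj
    have hs := slope_pos hε (n + 1)
    have hlt := slope_succ_lt hε n
    obtain ⟨hr0, hr1⟩ := re_mem_Icc_of_mem_kite (by linarith) h
    obtain ⟨h1, h2, h3, h4⟩ := h
    obtain ⟨p, rfl | rfl⟩ := j.even_or_odd'
    -- The segment is the base of the cap containing the smaller one. The latter rises from the
    -- base with slope at least that of the difference of the two base angles, which is positive.
    · left
      rw [Nat.mul_div_cancel_left p two_pos] at him ⊢
      rw [coord_of_left] at him
      have hre : (coord ε (n + 1) (2 * p) z).re = 0 := by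
        simp only at him
        nlinarith
      rw [hre] at h1 h3
      refine coord_injective ε (n + 1) (2 * p) ?_
      have : (ends ε n p).1 = (ends ε (n + 1) (2 * p)).1 := by rw [ends_left]
      rw [this, coord_left_end]
      exact Complex.ext hre (by rw [Complex.zero_im]; linarith)
    · right
      have hp : (2 * p + 1) / 2 = p := by lia
      rw [hp] at him ⊢
      rw [coord_of_right] at him
      have hre : (coord ε (n + 1) (2 * p + 1) z).re = 1 := by
        simp only at him
        nlinarith
      rw [hre] at h2 h4
      refine coord_injective ε (n + 1) (2 * p + 1) ?_
      have : (ends ε n p).2 = (ends ε (n + 1) (2 * p + 1)).2 := by rw [ends_right]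
      rw [this, coord_right_end]
      exact Complex.ext hre (by rw [Complex.one_im]; linarith)
  · exact eq_end_of_mem_region hε hε' hi (by lia) hij
      (cap_subset_region hε hε' n i (segment_subset_cap ε n i hzi))
      (cap_subset_region hε hε' n _ (cap_subset_cap hε hε' n j hzj))

/-! ### Caps, stages and the limit set -/

/-- The union of the caps of generation `n`. -/
def capUnion (ε : ℝ) (n : ℕ) : Set ℂ := ⋃ i ∈ Finset.range (2 ^ n), cap ε n i

lemma mem_capUnion {ε : ℝ} {n : ℕ} {z : ℂ} :
    z ∈ capUnion ε n ↔ ∃ i < 2 ^ n, z ∈ cap ε n i := by simp [capUnion]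

lemma mem_stage {ε : ℝ} {n : ℕ} {z : ℂ} :
    z ∈ stage ε n ↔ ∃ i < 2 ^ n, z ∈ segment ℝ (ends ε n i).1 (ends ε n i).2 := by simp [stage]

lemma isClosed_cap (ε : ℝ) (n i : ℕ) : IsClosed (cap ε n i) :=
  (Set.toFinite _).isClosed_convexHull ℝ

lemma isClosed_capUnion (ε : ℝ) (n : ℕ) : IsClosed (capUnion ε n) :=
  isClosed_biUnion_finset fun i _ ↦ isClosed_cap ε n i

lemma isClosed_stage (ε : ℝ) (n : ℕ) : IsClosed (stage ε n) := by
  refine isClosed_biUnion_finset fun i _ ↦ ?_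
  rw [← convexHull_pair]
  exact (Set.toFinite _).isClosed_convexHull ℝ

lemma stage_subset_capUnion (ε : ℝ) (n : ℕ) : stage ε n ⊆ capUnion ε n :=
  iUnion₂_mono fun i _ ↦ segment_subset_cap ε n i

lemma antitone_capUnion {ε : ℝ} (hε : 0 < ε) (hε' : ε < 1 / 8) : Antitone (capUnion ε) := by
  refine antitone_nat_of_succ_le fun n z hz ↦ ?_
  obtain ⟨i, hi, hz⟩ := mem_capUnion.1 hz
  rw [pow_succ] at hi
  exact mem_capUnion.2 ⟨i / 2, by lia, cap_subset_cap hε hε' n i hz⟩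

lemma limitSet_subset_capUnion {ε : ℝ} (hε : 0 < ε) (hε' : ε < 1 / 8) (N : ℕ) :
    limitSet ε ⊆ capUnion ε N := by
  rintro z ⟨hz, hz'⟩
  have hcl : IsClosed (capUnion ε N ∪ ⋃ n ∈ Finset.Ico 1 N, stage ε n) :=
    (isClosed_capUnion ε N).union (isClosed_biUnion_finset fun n _ ↦ isClosed_stage ε n)
  have hsub : (⋃ n ∈ Ici 1, stage ε n) ⊆ capUnion ε N ∪ ⋃ n ∈ Finset.Ico 1 N, stage ε n := by
    refine iUnion₂_subset fun n hn ↦ ?_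
    rcases le_or_gt N n with h | h
    · exact ((stage_subset_capUnion ε n).trans (antitone_capUnion hε hε' h)).trans
        subset_union_left
    · exact (subset_biUnion_of_mem (u := stage ε) (Finset.mem_coe.2 (Finset.mem_Ico.2
        ⟨mem_Ici.1 hn, h⟩))).trans subset_union_right
  rcases closure_minimal hsub hcl hz with h | h
  · exact h
  · obtain ⟨n, hn, h⟩ := mem_iUnion₂.1 h
    exact absurd (mem_iUnion₂.2 ⟨n, (Finset.mem_Ico.1 hn).1, h⟩) hz'

lemma end_mem_stage {ε : ℝ} {n i : ℕ} {z : ℂ} (hi : i < 2 ^ n)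
    (h : z = (ends ε n i).1 ∨ z = (ends ε n i).2) : z ∈ stage ε n := by
  refine mem_stage.2 ⟨i, hi, ?_⟩
  rcases h with rfl | rfl
  exacts [left_mem_segment ℝ _ _, right_mem_segment ℝ _ _]

/-- End points of segments stay end points in all later generations. -/
lemma exists_eq_end_of_le {ε : ℝ} {n m i : ℕ} {z : ℂ} (hnm : n ≤ m) (hi : i < 2 ^ n)
    (h : z = (ends ε n i).1 ∨ z = (ends ε n i).2) :
    ∃ j < 2 ^ m, z = (ends ε m j).1 ∨ z = (ends ε m j).2 := by
  induction m, hnm using Nat.le_induction with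
  | base => exact ⟨i, hi, h⟩
  | succ m _ ih =>
    obtain ⟨j, hj, h | h⟩ := ih
    · exact ⟨2 * j, by rw [pow_succ]; lia, .inl (by rw [ends_left, h])⟩
    · exact ⟨2 * j + 1, by rw [pow_succ]; lia, .inr (by rw [ends_right, h])⟩

lemma existsUnique_mem_cap {ε : ℝ} (hε : 0 < ε) (hε' : ε < 1 / 8) {z : ℂ} (hz : z ∈ limitSet ε)
    (n : ℕ) : ∃! i, i < 2 ^ n ∧ z ∈ cap ε n i := by
  obtain ⟨i, hi, hzi⟩ := mem_capUnion.1 (limitSet_subset_capUnion hε hε' n hz)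
  refine ⟨i, ⟨hi, hzi⟩, fun j ⟨hj, hzj⟩ ↦ by_contra fun hji ↦ hz.2 ?_⟩
  -- Stage `0` is not removed from the closure, so a stage of positive generation is used.
  have h := eq_end_of_mem_region hε hε' hj hi hji (cap_subset_region hε hε' n j hzj)
    (cap_subset_region hε hε' n i hzi)
  obtain ⟨k, hk, h⟩ := exists_eq_end_of_le n.le_succ hj h
  exact mem_iUnion₂.2 ⟨n + 1, by simp, end_mem_stage hk h⟩

/-! ### Edge points, the radii, and closedness -/

lemma edgePoint_apex (ε : ℝ) {n i : ℕ} (hi : i < 2 ^ n) :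
    edgePoint ε (2 + 2 ^ n + i) = apex ε n i := by
  have h1 : 2 + 2 ^ n + i - 2 = 2 ^ n + i := by lia
  have h2 : Nat.log 2 (2 ^ n + i) = n :=
    Nat.log_eq_of_pow_le_of_lt_pow (by lia) (by rw [pow_succ]; lia)
  have h3 := Nat.two_pow_pos n
  rw [edgePoint, if_neg (by lia), if_neg (by lia), h1, h2, Nat.add_sub_cancel_left]

lemma exists_edgePoint_eq_end (ε : ℝ) {n i : ℕ} (hi : i < 2 ^ n) :
    (∃ k ≥ 1, edgePoint ε k = (ends ε n i).1) ∧ ∃ k ≥ 1, edgePoint ε k = (ends ε n i).2 := by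
  induction n generalizing i with
  | zero => exact ⟨⟨1, le_rfl, by simp [edgePoint, ends_zero]⟩,
      ⟨2, by simp, by simp [edgePoint, ends_zero]⟩⟩
  | succ n ih =>
    rw [pow_succ] at hi
    obtain ⟨p, rfl | rfl⟩ := i.even_or_odd'
    · rw [ends_left]
      exact ⟨(ih (by lia)).1, _, by lia, edgePoint_apex ε (i := p) (n := n) (by lia)⟩
    · rw [ends_right]
      exact ⟨⟨_, by lia, edgePoint_apex ε (i := p) (n := n) (by lia)⟩, (ih (by lia)).2⟩

lemma apex_ne_end {ε : ℝ} (hε : 0 < ε) (n i : ℕ) :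
    ¬ (apex ε n i = (ends ε n i).1 ∨ apex ε n i = (ends ε n i).2) := by
  have hs := slope_pos hε n
  have h0 : (coord ε n i (apex ε n i)).im ≠ 0 := by rw [coord_apex]; simpa using hs.ne'
  rintro (h | h) <;> apply h0 <;> rw [h]
  · rw [coord_left_end]; rfl
  · rw [coord_right_end]; rfl

lemma apex_mem_cap (ε : ℝ) (n i : ℕ) : apex ε n i ∈ cap ε n i :=
  subset_convexHull ℝ _ (by simp)

lemma apex_notMem_stage {ε : ℝ} (hε : 0 < ε) (hε' : ε < 1 / 8) {m n i : ℕ} (hmn : m < n)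
    (hi : i < 2 ^ n) : apex ε n i ∉ stage ε m := by
  intro h
  obtain ⟨j, hj, hseg⟩ := mem_stage.1 h
  obtain ⟨k, hk, hcap⟩ := mem_capUnion.1 (antitone_capUnion hε hε' (Nat.succ_le_of_lt hmn)
    (mem_capUnion.2 ⟨i, hi, apex_mem_cap ε n i⟩))
  have hend := eq_end_of_mem_cap_of_mem_segment hε hε' hj hk hcap hseg
  obtain ⟨l, hl, hend⟩ := exists_eq_end_of_le hmn.le hj hend
  rcases eq_or_ne i l with rfl | hil
  · exact apex_ne_end hε n i hend
  refine apex_ne_end hε n i (eq_end_of_mem_region hε hε' hi hl hil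
    (cap_subset_region hε hε' n i (apex_mem_cap ε n i)) (cap_subset_region hε hε' n l ?_))
  rcases hend with h | h <;> rw [h]
  exacts [subset_convexHull ℝ _ (by simp), subset_convexHull ℝ _ (by simp)]

lemma rho_pos (ε : ℝ) (k : ℕ) : 0 < rho ε k := by unfold rho; positivity

lemma radius_le_rho (ε : ℝ) (k : ℕ) : radius ε k ≤ rho ε k := by
  unfold radius; split_ifs
  exacts [le_rfl, min_le_left _ _]

lemma radius_pos {ε : ℝ} (hε : 0 < ε) (hε' : ε < 1 / 8) (k : ℕ) : 0 < radius ε k := by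
  unfold radius
  split_ifs with hk
  · exact rho_pos ε k
  -- The generation of `e_k` is `log₂ (k - 2)`, and it exceeds those of the two stages.
  have h2 : 2 ≤ Nat.log 2 (k - 1) := Nat.le_log_of_pow_le (by norm_num) (by lia)
  have hle : Nat.log 2 (k - 1) - 1 ≤ Nat.log 2 (k - 2) := by
    refine Nat.le_log_of_pow_le (by norm_num) ?_
    have h1 : 2 ^ Nat.log 2 (k - 1) ≤ k - 1 := Nat.pow_log_le_self 2 (by lia)
    obtain ⟨p, hp⟩ : ∃ p, Nat.log 2 (k - 1) = p + 2 := ⟨_, (Nat.sub_add_cancel h2).symm⟩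
    rw [hp, pow_succ] at h1
    rw [hp, Nat.add_sub_assoc (by norm_num)]
    have := Nat.two_pow_pos (p + 1)
    show 2 ^ (p + 1) ≤ k - 2
    lia
  have hlog : k - 2 < 2 ^ (Nat.log 2 (k - 2) + 1) := Nat.lt_pow_succ_log_self (by norm_num) _
  rw [pow_succ] at hlog
  have hlt : k - 2 - 2 ^ Nat.log 2 (k - 2) < 2 ^ Nat.log 2 (k - 2) := by lia
  refine lt_min (rho_pos ε k) (half_pos ?_)
  have he : edgePoint ε k = apex ε (Nat.log 2 (k - 2)) (k - 2 - 2 ^ Nat.log 2 (k - 2)) := by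
    rw [edgePoint, if_neg (by lia), if_neg (by lia)]
  have hne : (stage ε (Nat.log 2 (k - 1) - 1 - 1) ∪
      stage ε (Nat.log 2 (k - 1) - 1 - 2)).Nonempty :=
    ⟨_, .inl (end_mem_stage (Nat.two_pow_pos _) (.inl rfl))⟩
  refine (((isClosed_stage ε _).union (isClosed_stage ε _)).notMem_iff_infDist_pos hne).1 ?_
  rw [he]
  rintro (h | h)
  · exact apex_notMem_stage hε hε' (by lia) hlt h
  · exact apex_notMem_stage hε hε' (by lia) hlt h

/-- A limit of points of `A_ε` that lies on stage `n` also lies in a cap of generation `n + 1`,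
hence is an edge point, around which a ball has been removed. -/
lemma isClosed_closedLimitSet {ε : ℝ} (hε : 0 < ε) (hε' : ε < 1 / 8) :
    IsClosed (closedLimitSet ε) := by
  refine isClosed_of_closure_subset fun z hz ↦ ?_
  have hsub : closedLimitSet ε ⊆ limitSet ε := sdiff_subset
  have hball : z ∉ ⋃ k ∈ Ici 1, Metric.ball (edgePoint ε k) (radius ε k) := by
    have : IsOpen (⋃ k ∈ Ici 1, Metric.ball (edgePoint ε k) (radius ε k)) :=
      isOpen_biUnion fun _ _ ↦ Metric.isOpen_ball
    exact closure_minimal (fun _ h ↦ h.2) this.isClosed_compl hz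
  refine ⟨⟨closure_minimal (fun _ h ↦ h.1.1) isClosed_closure hz, fun hst ↦ hball ?_⟩, hball⟩
  obtain ⟨n, -, hst⟩ := mem_iUnion₂.1 hst
  obtain ⟨i, hi, hseg⟩ := mem_stage.1 hst
  obtain ⟨j, hj, hcap⟩ := mem_capUnion.1 (closure_minimal
    (hsub.trans (limitSet_subset_capUnion hε hε' (n + 1))) (isClosed_capUnion ε (n + 1)) hz)
  have hk : ∃ k ≥ 1, edgePoint ε k = z := by
    rcases eq_end_of_mem_cap_of_mem_segment hε hε' hi hj hcap hseg with h | h <;> rw [h]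
    exacts [(exists_edgePoint_eq_end ε hi).1, (exists_edgePoint_eq_end ε hi).2]
  obtain ⟨k, hk, rfl⟩ := hk
  exact mem_iUnion₂.2 ⟨k, hk, Metric.mem_ball_self (radius_pos hε hε' k)⟩

/-! ### Counting the caps near a point -/

/-- The midpoint of the segment `A_{n,i}`. -/
noncomputable def center (ε : ℝ) (n i : ℕ) : ℂ :=
  (1 / 2 : ℝ) • (ends ε n i).1 + (1 / 2 : ℝ) • (ends ε n i).2

lemma coord_center (ε : ℝ) (n i : ℕ) : coord ε n i (center ε n i) = (1 / 2 : ℝ) := by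
  rw [center, coord_combo ε n i _ _ (by norm_num), coord_left_end, coord_right_end]
  simp

lemma norm_sub_ofReal_sq (w : ℂ) (a : ℝ) : ‖w - a‖ ^ 2 = (w.re - a) ^ 2 + w.im ^ 2 := by
  rw [Complex.sq_norm, Complex.normSq_apply]
  simp; ring

lemma cap_subset_closedBall {ε : ℝ} (hε : 0 < ε) (hε' : ε < 1 / 8) (n i : ℕ) :
    cap ε n i ⊆ Metric.closedBall (center ε n i) (sideLength ε n / 2) := by
  intro z hz
  have hs := slope_pos hε n
  have hs' := slope_lt_half hε' n
  have hk := coord_mem_kite_of_mem_cap hε hz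
  obtain ⟨hr0, hr1⟩ := re_mem_Icc_of_mem_kite (by linarith) hk
  obtain ⟨h1, h2, h3, h4⟩ := hk
  have h : ‖coord ε n i z - (1 / 2 : ℝ)‖ ≤ 1 / 2 := by
    refine abs_le_of_sq_le_sq' ?_ (by norm_num) |>.2
    rw [norm_sub_ofReal_sq]
    have h5 : (coord ε n i z).im ≤ 1 / 2 * (coord ε n i z).re := h1.trans (by gcongr)
    have h6 : (coord ε n i z).im ≤ 1 / 2 * (1 - (coord ε n i z).re) :=
      h2.trans (by gcongr)
    nlinarith
  rw [Metric.mem_closedBall, dist_eq_norm, norm_sub_eq_sideLength_mul ε n i, coord_center]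
  linarith [mul_le_mul_of_nonneg_left h (sideLength_pos ε n).le]

/-- In the coordinates of the segment, the sides of slope `± 1 / 2` have distance
`1 / (2 √5) > 1 / 5` from the midpoint. -/
lemma ball_subset_region {ε : ℝ} (hε : 0 < ε) (hε' : ε < 1 / 8) (n i : ℕ) :
    Metric.ball (center ε n i) (sideLength ε n / 5) ⊆ region ε n i := by
  intro z hz
  have hb := sideLength_pos ε n
  rw [Metric.mem_ball, dist_eq_norm, norm_sub_eq_sideLength_mul ε n i, coord_center] at hz
  have hz : ‖coord ε n i z - (1 / 2 : ℝ)‖ < 1 / 5 := by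
    by_contra! h
    linarith [mul_le_mul_of_nonneg_left h hb.le]
  have hz : ‖coord ε n i z - (1 / 2 : ℝ)‖ ^ 2 < (1 / 5) ^ 2 := by gcongr
  rw [norm_sub_ofReal_sq] at hz
  refine kite_subset_kite (H := 1 / 2) (s := 1 / 2) (by norm_num) (by norm_num) ?_ le_rfl ?_
  · linarith [half_le_widen (slope_pos hε n) (slope_lt_half hε' n), slope_pos hε n]
  · generalize coord ε n i z = w at hz
    refine ⟨?_, ?_, ?_, ?_⟩ <;> by_contra! h <;>
      nlinarith [sq_nonneg (w.im + 2 * (w.re - 1 / 2)), sq_nonneg (w.im - 2 * (w.re - 1 / 2))]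

lemma dist_center_end (ε : ℝ) {n i : ℕ} {z : ℂ} (h : z = (ends ε n i).1 ∨ z = (ends ε n i).2) :
    dist z (center ε n i) = sideLength ε n / 2 := by
  rw [dist_eq_norm, norm_sub_eq_sideLength_mul ε n i, coord_center]
  rcases h with rfl | rfl
  · rw [coord_left_end, zero_sub, norm_neg, Complex.norm_real]; norm_num; ring
  · rw [coord_right_end, ← Complex.ofReal_one, ← Complex.ofReal_sub, Complex.norm_real]
    norm_num; ring

open scoped Classical in
/-- The indices of the caps of generation `n` that meet the closed ball of radius `r` around `x`. -/
noncomputable def capsMeeting (ε : ℝ) (n : ℕ) (x : ℂ) (r : ℝ) : Finset ℕ :=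
  (Finset.range (2 ^ n)).filter fun i ↦ (cap ε n i ∩ Metric.closedBall x r).Nonempty

/-- The discs of radius `b / 5` around the midpoints of the segments of length `b` lie in the
widened caps, so they are disjoint, and comparing areas bounds the number of caps near a point. -/
lemma card_capsMeeting_mul_le {ε : ℝ} (hε : 0 < ε) (hε' : ε < 1 / 8) (n : ℕ) (x : ℂ) {r : ℝ}
    (hr : 0 ≤ r) : ((capsMeeting ε n x r).card : ℝ) * sideLength ε n ^ 2 ≤
      25 * (r + 7 / 10 * sideLength ε n) ^ 2 := by
  classical
  have hb := sideLength_pos ε n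
  set b := sideLength ε n
  have hdisj : PairwiseDisjoint (↑(capsMeeting ε n x r))
      fun i ↦ Metric.ball (center ε n i) (b / 5) := by
    intro i hi j hj hij
    rw [capsMeeting, Finset.mem_coe, Finset.mem_filter, Finset.mem_range] at hi hj
    refine disjoint_left.2 fun z hzi hzj ↦ ?_
    have hend := eq_end_of_mem_region hε hε' hi.1 hj.1 hij (ball_subset_region hε hε' n i hzi)
      (ball_subset_region hε hε' n j hzj)
    have := dist_center_end ε hend
    rw [Metric.mem_ball, this] at hzi
    simp only [b] at *
    linarith
  have hsub : (⋃ i ∈ capsMeeting ε n x r, Metric.ball (center ε n i) (b / 5)) ⊆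
      Metric.ball x (r + 7 / 10 * b) := by
    refine iUnion₂_subset fun i hi z hz ↦ ?_
    rw [capsMeeting, Finset.mem_filter] at hi
    obtain ⟨y, hy, hyx⟩ := hi.2
    have h1 := cap_subset_closedBall hε hε' n i hy
    rw [Metric.mem_closedBall] at h1 hyx
    rw [Metric.mem_ball] at hz ⊢
    have h2 := dist_triangle z (center ε n i) x
    have h3 := dist_triangle (center ε n i) y x
    rw [dist_comm _ y] at h3
    simp only [b] at *
    linarith
  have hvol := measure_mono (μ := volume) hsub
  rw [measure_biUnion_finset hdisj fun _ _ ↦ Metric.isOpen_ball.measurableSet] at hvol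
  simp only [Complex.volume_ball, Finset.sum_const, nsmul_eq_mul, ← mul_assoc] at hvol
  have hpi : (NNReal.pi : ENNReal) ≠ 0 := by
    simpa using NNReal.pi_ne_zero
  rw [ENNReal.mul_le_mul_iff_left hpi ENNReal.coe_ne_top, ← ENNReal.ofReal_pow (by positivity),
    ← ENNReal.ofReal_pow (by positivity), ← ENNReal.ofReal_natCast,
    ← ENNReal.ofReal_mul (by positivity), ENNReal.ofReal_le_ofReal_iff (by positivity)] at hvol
  linarith

/-! ### The natural measure on the limit curve -/

/-- The natural parametrization of the limit curve: the dyadic interval of generation `n` with index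
`i` is mapped into the cap `T_{n,i}`. For `t` outside `[0, 1)` the value has no meaning. -/
noncomputable def param (ε : ℝ) (t : ℝ) : ℂ :=
  limUnder atTop fun n ↦ (ends ε n ⌊2 ^ n * t⌋₊).1

lemma floor_succ_div_two (n : ℕ) (t : ℝ) : ⌊2 ^ (n + 1) * t⌋₊ / 2 = ⌊2 ^ n * t⌋₊ := by
  rw [← Nat.floor_div_ofNat, pow_succ]
  congr 1
  ring

lemma exists_forall_mem_cap {ε : ℝ} (hε : 0 < ε) (hε' : ε < 1 / 8) (t : ℝ) :
    ∃ z, ∀ n, z ∈ cap ε n ⌊2 ^ n * t⌋₊ := by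
  have h := IsCompact.nonempty_iInter_of_sequence_nonempty_isCompact_isClosed
    (fun n ↦ cap ε n ⌊2 ^ n * t⌋₊)
    (fun n ↦ by simpa only [floor_succ_div_two] using cap_subset_cap hε hε' n ⌊2 ^ (n + 1) * t⌋₊)
    (fun n ↦ ⟨_, apex_mem_cap ε n _⟩) ((Set.toFinite _).isCompact_convexHull ℝ)
    (fun n ↦ isClosed_cap ε n _)
  simpa [Set.Nonempty] using h

lemma tendsto_param {ε : ℝ} (hε : 0 < ε) (hε' : ε < 1 / 8) (t : ℝ) :
    Tendsto (fun n ↦ (ends ε n ⌊2 ^ n * t⌋₊).1) atTop (𝓝 (param ε t)) ∧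
      ∀ n, param ε t ∈ cap ε n ⌊2 ^ n * t⌋₊ := by
  obtain ⟨z, hz⟩ := exists_forall_mem_cap hε hε' t
  have h : Tendsto (fun n ↦ (ends ε n ⌊2 ^ n * t⌋₊).1) atTop (𝓝 z) := by
    rw [tendsto_iff_dist_tendsto_zero]
    refine squeeze_zero (fun n ↦ dist_nonneg) (fun n ↦ ?_) (tendsto_sideLength hε hε')
    have h1 := cap_subset_closedBall hε hε' n _ (hz n)
    have h2 := dist_center_end ε (n := n) (i := ⌊2 ^ n * t⌋₊) (.inl rfl)
    rw [Metric.mem_closedBall] at h1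
    linarith [dist_triangle_right (ends ε n ⌊2 ^ n * t⌋₊).1 z (center ε n ⌊2 ^ n * t⌋₊)]
  have hl : param ε t = z := h.limUnder_eq
  exact ⟨hl ▸ h, hl ▸ hz⟩

lemma measurable_param {ε : ℝ} (hε : 0 < ε) (hε' : ε < 1 / 8) : Measurable (param ε) := by
  refine measurable_of_tendsto_metrizable (f := fun n t ↦ (ends ε n ⌊2 ^ n * t⌋₊).1) (fun n ↦ ?_)
    (tendsto_pi_nhds.2 fun t ↦ (tendsto_param hε hε' t).1)
  exact (measurable_from_top (f := fun i : ℕ ↦ (ends ε n i).1)).comp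
    (Nat.measurable_floor.comp (measurable_const_mul _))

/-- The measure on the limit curve that gives mass `2 ^ (-n)` to each cap of generation `n`. -/
noncomputable def naturalMeasure (ε : ℝ) : Measure ℂ :=
  (volume.restrict (Ico (0 : ℝ) 1)).map (param ε)

lemma floor_lt_two_pow {t : ℝ} (ht : t ∈ Ico (0 : ℝ) 1) (n : ℕ) : ⌊2 ^ n * t⌋₊ < 2 ^ n := by
  rw [Nat.floor_lt (mul_nonneg (by positivity) ht.1)]
  push_cast
  exact mul_lt_of_lt_one_right (by positivity) ht.2

lemma naturalMeasure_univ {ε : ℝ} (hε : 0 < ε) (hε' : ε < 1 / 8) :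
    naturalMeasure ε univ = 1 := by
  rw [naturalMeasure, Measure.map_apply (measurable_param hε hε') .univ]
  simp

lemma naturalMeasure_compl_closure {ε : ℝ} (hε : 0 < ε) (hε' : ε < 1 / 8) :
    naturalMeasure ε (closure (⋃ n ∈ Ici 1, stage ε n))ᶜ = 0 := by
  have hm : MeasurableSet (closure (⋃ n ∈ Ici 1, stage ε n))ᶜ :=
    isClosed_closure.isOpen_compl.measurableSet
  rw [naturalMeasure, Measure.map_apply (measurable_param hε hε') hm,
    Measure.restrict_apply (measurable_param hε hε' hm)]
  refine measure_mono_null (t := ∅) (fun t ⟨h, ht⟩ ↦ h ?_) measure_empty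
  refine mem_closure_of_tendsto (tendsto_param hε hε' t).1 ?_
  filter_upwards [eventually_ge_atTop 1] with n hn
  exact mem_iUnion₂.2 ⟨n, hn, end_mem_stage (floor_lt_two_pow ht n) (.inl rfl)⟩

lemma naturalMeasure_closedBall_le_card {ε : ℝ} (hε : 0 < ε) (hε' : ε < 1 / 8) (n : ℕ) (x : ℂ)
    (r : ℝ) : naturalMeasure ε (Metric.closedBall x r) ≤
      ENNReal.ofReal ((capsMeeting ε n x r).card / 2 ^ n) := by
  classical
  rw [naturalMeasure, Measure.map_apply (measurable_param hε hε') measurableSet_closedBall,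
    Measure.restrict_apply (measurable_param hε hε' measurableSet_closedBall)]
  have hsub : param ε ⁻¹' Metric.closedBall x r ∩ Ico 0 1 ⊆
      ⋃ i ∈ capsMeeting ε n x r, Icc ((i : ℝ) / 2 ^ n) ((i + 1) / 2 ^ n) := by
    rintro t ⟨htx, ht⟩
    refine mem_iUnion₂.2 ⟨⌊2 ^ n * t⌋₊, ?_, ?_, ?_⟩
    · rw [capsMeeting, Finset.mem_filter, Finset.mem_range]
      exact ⟨floor_lt_two_pow ht n, _, (tendsto_param hε hε' t).2 n, htx⟩
    · rw [div_le_iff₀' (by positivity)]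
      exact Nat.floor_le (mul_nonneg (by positivity) ht.1)
    · rw [le_div_iff₀' (by positivity)]
      exact (Nat.lt_floor_add_one _).le
  refine (measure_mono hsub).trans ((measure_biUnion_finset_le _ _).trans ?_)
  have h : ∀ i : ℕ, ((i : ℝ) + 1) / 2 ^ n - i / 2 ^ n = (2 ^ n)⁻¹ := fun i ↦ by ring
  simp only [Real.volume_Icc, h, Finset.sum_const, nsmul_eq_mul]
  rw [div_eq_mul_inv, ENNReal.ofReal_mul (by positivity), ENNReal.ofReal_natCast]

/-- A ball of radius `r ≈ b_n` meets boundedly many of the `2 ^ n` caps of generation `n`, and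
`2 ^ n b_n` is the total length of generation `n`. The constant is the one needed for the balls
around the edge points. -/
lemma naturalMeasure_closedBall_le {ε : ℝ} (hε : 0 < ε) (hε' : ε < 1 / 8) {N : ℕ} (x : ℂ) {r : ℝ}
    (hr : 0 < r) (hrN : r ≤ sideLength ε N) :
    naturalMeasure ε (Metric.closedBall x r) ≤ ENNReal.ofReal (75 / totalLength ε N * r) := by
  classical
  -- The scale is the last `n ≥ N` before the side length drops below `r`.
  have hex : ∃ m, N ≤ m ∧ sideLength ε m < r :=
    ((eventually_ge_atTop N).and ((tendsto_sideLength hε hε').eventually_lt_const hr)).exists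
  obtain ⟨hNm, hm⟩ := Nat.find_spec hex
  have hmin := fun k ↦ Nat.find_min hex (m := k)
  generalize Nat.find hex = m at *
  obtain ⟨n, rfl⟩ : ∃ n, m = n + 1 := by
    refine Nat.exists_eq_succ_of_ne_zero ?_
    rintro rfl
    obtain rfl : N = 0 := by lia
    linarith
  have hNn : N ≤ n := by
    by_contra h
    obtain rfl : N = n + 1 := by lia
    linarith
  have hrn : r ≤ sideLength ε n := by
    by_contra! h
    exact hmin n n.lt_succ_self ⟨hNn, h⟩
  have hn := half_sideLength_lt_succ hε n
  have hL := totalLength_pos ε N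
  have hL' := totalLength_mono ε hNn
  have hb := sideLength_pos ε n
  refine (naturalMeasure_closedBall_le_card hε hε' n x r).trans (ENNReal.ofReal_le_ofReal ?_)
  have hcard := card_capsMeeting_mul_le hε hε' n x hr.le
  have hbL : sideLength ε n * 2 ^ n = totalLength ε n := div_mul_cancel₀ _ (by positivity)
  -- The quadratic is convex in `r`, hence it suffices to check `r = b / 2` and `r = b`.
  have hquad : 25 * (r + 7 / 10 * sideLength ε n) ^ 2 ≤ 75 * r * sideLength ε n := by
    nlinarith [mul_nonneg (sub_nonneg.2 hrn) (by linarith : 0 ≤ r - sideLength ε n / 2)]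
  have hcard' : ((capsMeeting ε n x r).card : ℝ) * sideLength ε n ≤ 75 * r := by
    by_contra! h
    nlinarith [mul_lt_mul_of_pos_right h hb]
  rw [div_mul_eq_mul_div, div_le_div_iff₀ (by positivity) hL]
  calc ((capsMeeting ε n x r).card : ℝ) * totalLength ε N
      ≤ (capsMeeting ε n x r).card * totalLength ε n := by gcongr
    _ = (capsMeeting ε n x r).card * sideLength ε n * 2 ^ n := by rw [← hbL]; ring
    _ ≤ 75 * r * 2 ^ n := by gcongr

/-! ### Sets of finite length are null sets -/

/-- Since the total lengths tend to infinity, the natural measure is `o(r)` on balls of radius `r`,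
so it is dominated by every positive multiple of the Hausdorff measure. -/
lemma naturalMeasure_le_mul_hausdorffMeasure {ε : ℝ} (hε : 0 < ε) (hε' : ε < 1 / 8) {κ : ℝ}
    (hκ : 0 < κ) (s : Set ℂ) : naturalMeasure ε s ≤ ENNReal.ofReal κ * μH[1] s := by
  obtain ⟨N, hN⟩ := ((tendsto_totalLength hε).eventually_ge_atTop (75 / κ)).exists
  have hL := totalLength_pos ε N
  have hb := sideLength_pos ε N
  have hκN : 75 / totalLength ε N ≤ κ := by
    rw [div_le_iff₀ hκ] at hN
    rwa [div_le_iff₀' hL]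
  have hκ0 : ENNReal.ofReal κ ≠ 0 := by simpa using hκ
  have key : (ENNReal.ofReal κ)⁻¹ • naturalMeasure ε ≤ μH[1] := by
    refine Measure.le_hausdorffMeasure 1 _ (ENNReal.ofReal (sideLength ε N / 2)) (by simpa) ?_
    intro s hs
    rcases s.eq_empty_or_nonempty with rfl | ⟨x, hx⟩
    · simp
    rw [Measure.smul_apply, smul_eq_mul, ENNReal.rpow_one,
      ENNReal.inv_mul_le_iff hκ0 ENNReal.ofReal_ne_top]
    have hfin : Metric.ediam s ≠ ⊤ := ne_top_of_le_ne_top ENNReal.ofReal_ne_top hs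
    have hd : ENNReal.ofReal (Metric.diam s) = Metric.ediam s := ENNReal.ofReal_toReal hfin
    have hdN : Metric.diam s < sideLength ε N := by
      rw [← hd, ENNReal.ofReal_le_ofReal_iff (by positivity)] at hs
      linarith
    rw [← hd, ← ENNReal.ofReal_mul hκ.le]
    have hcont : Tendsto (fun r ↦ ENNReal.ofReal (κ * r)) (𝓝[>] Metric.diam s)
        (𝓝 (ENNReal.ofReal (κ * Metric.diam s))) :=
      ((ENNReal.continuous_ofReal.comp (continuous_const_mul κ)).tendsto _).mono_left
        nhdsWithin_le_nhds
    refine ge_of_tendsto hcont ?_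
    filter_upwards [Ioc_mem_nhdsGT hdN] with r hr
    have hr0 : 0 < r := Metric.diam_nonneg.trans_lt hr.1
    refine (measure_mono fun y hy ↦ ?_).trans
      ((naturalMeasure_closedBall_le hε hε' x hr0 hr.2).trans (ENNReal.ofReal_le_ofReal ?_))
    · exact (Metric.dist_le_diam_of_mem' hfin hy hx).trans hr.1.le
    · gcongr
  have := key s
  rwa [Measure.smul_apply, smul_eq_mul, ENNReal.inv_mul_le_iff hκ0 ENNReal.ofReal_ne_top] at this

lemma naturalMeasure_eq_zero {ε : ℝ} (hε : 0 < ε) (hε' : ε < 1 / 8) {s : Set ℂ}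
    (hs : μH[1] s ≠ ⊤) : naturalMeasure ε s = 0 := by
  have h : Tendsto (fun κ ↦ ENNReal.ofReal κ * μH[1] s) (𝓝[>] 0) (𝓝 0) := by
    have h1 : Tendsto ENNReal.ofReal (𝓝[>] 0) (𝓝 0) := by
      simpa using (ENNReal.continuous_ofReal.tendsto 0).mono_left nhdsWithin_le_nhds
    simpa using ENNReal.Tendsto.mul_const h1 (.inr hs)
  refine le_antisymm (ge_of_tendsto h ?_) zero_le
  filter_upwards [self_mem_nhdsWithin] with κ hκ
  exact naturalMeasure_le_mul_hausdorffMeasure hε hε' hκ s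

lemma naturalMeasure_range_eq_zero {ε : ℝ} (hε : 0 < ε) (hε' : ε < 1 / 8) {F : ℝ → ℂ}
    {K : NNReal} (hF : LipschitzWith K F) : naturalMeasure ε (range F) = 0 := by
  rw [← image_univ, ← Metric.iUnion_closedBall_nat (0 : ℝ), image_iUnion, measure_iUnion_null_iff]
  refine fun n ↦ naturalMeasure_eq_zero hε hε' (ne_top_of_le_ne_top ?_
    (hF.hausdorffMeasure_image_le zero_le_one _))
  rw [hausdorffMeasure_real, ENNReal.rpow_one]
  exact ENNReal.mul_ne_top ENNReal.coe_ne_top measure_closedBall_lt_top.ne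

/-- Of rectifiability only the consequence is used that the set has `σ`-finite one-dimensional
Hausdorff measure. -/
lemma CountablyOneRectifiable.naturalMeasure_eq_zero {ε : ℝ} (hε : 0 < ε) (hε' : ε < 1 / 8)
    {M : Set ℂ} (hM : CountablyOneRectifiable M) : naturalMeasure ε M = 0 := by
  obtain ⟨M₀, F, hM₀, hF, hsub⟩ := hM
  refine measure_mono_null hsub (measure_union_null
    (Koch.naturalMeasure_eq_zero hε hε' (by simp [hM₀])) (measure_iUnion_null fun j ↦ ?_))
  obtain ⟨K, hK⟩ := hF j
  exact naturalMeasure_range_eq_zero hε hε' hK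

lemma CountablyOneRectifiable.mono {M N : Set ℂ} (hN : CountablyOneRectifiable N) (h : M ⊆ N) :
    CountablyOneRectifiable M := by
  obtain ⟨M₀, F, hM₀, hF, hsub⟩ := hN
  exact ⟨M₀, F, hM₀, hF, h.trans hsub⟩

lemma naturalMeasure_stage {ε : ℝ} (hε : 0 < ε) (hε' : ε < 1 / 8) (n : ℕ) :
    naturalMeasure ε (stage ε n) = 0 := by
  refine (measure_biUnion_null_iff (Finset.countable_toSet _)).2 fun i _ ↦
    naturalMeasure_eq_zero hε hε' ?_
  rw [hausdorffMeasure_segment]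
  exact edist_ne_top _ _

lemma naturalMeasure_compl_limitSet {ε : ℝ} (hε : 0 < ε) (hε' : ε < 1 / 8) :
    naturalMeasure ε (limitSet ε)ᶜ = 0 := by
  rw [limitSet, sdiff_eq, compl_inter, compl_compl]
  exact measure_union_null (naturalMeasure_compl_closure hε hε')
    ((measure_biUnion_null_iff (to_countable _)).2 fun n _ ↦ naturalMeasure_stage hε hε' n)

lemma rho_le {ε : ℝ} (hε : 0 < ε) (hε' : ε < 1 / 8) (k : ℕ) :
    rho ε k ≤ 4 / 4 ^ k * (1 / 4 * (1 / 2 ^ 7) * 2) := by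
  have : √(1 + 7 * 16 * ε ^ 2) ≤ 2 := Real.sqrt_le_iff.2 ⟨by norm_num, by nlinarith [hε, hε']⟩
  unfold rho
  gcongr

lemma naturalMeasure_ball_le {ε : ℝ} (hε : 0 < ε) (hε' : ε < 1 / 8) (k : ℕ) :
    naturalMeasure ε (Metric.ball (edgePoint ε (k + 1)) (radius ε (k + 1))) ≤
      ENNReal.ofReal (75 / 256 * (1 / 4) ^ k) := by
  have hL : totalLength ε 0 = 1 := by simp [totalLength]
  have hb : sideLength ε 0 = 1 := by simp [sideLength, hL]
  have h4 : (4 : ℝ) / 4 ^ (k + 1) = (1 / 4) ^ k := by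
    rw [pow_succ, one_div, inv_pow]; field_simp
  have hrho := (radius_le_rho ε (k + 1)).trans (rho_le hε hε' (k + 1))
  rw [h4] at hrho
  have hk : (1 / 4 : ℝ) ^ k ≤ 1 := pow_le_one₀ (by norm_num) (by norm_num)
  refine (measure_mono Metric.ball_subset_closedBall).trans
    ((naturalMeasure_closedBall_le hε hε' (N := 0) _ (radius_pos hε hε' _) ?_).trans
      (ENNReal.ofReal_le_ofReal ?_))
  · rw [hb]; linarith
  · rw [hL]; linarith

/-- The radii are summable with a small sum, so removing the balls leaves positive measure. -/
lemma naturalMeasure_iUnion_ball_lt_one {ε : ℝ} (hε : 0 < ε) (hε' : ε < 1 / 8) :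
    naturalMeasure ε (⋃ k ∈ Ici 1, Metric.ball (edgePoint ε k) (radius ε k)) < 1 := by
  have hsub : (⋃ k ∈ Ici 1, Metric.ball (edgePoint ε k) (radius ε k)) ⊆
      ⋃ k, Metric.ball (edgePoint ε (k + 1)) (radius ε (k + 1)) := by
    refine iUnion₂_subset fun k hk ↦ ?_
    obtain ⟨m, rfl⟩ := Nat.exists_eq_add_of_le' (mem_Ici.1 hk)
    exact subset_iUnion (fun k ↦ Metric.ball (edgePoint ε (k + 1)) (radius ε (k + 1))) m
  have hgeo := (hasSum_geometric_of_lt_one (r := (1 / 4 : ℝ)) (by norm_num)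
    (by norm_num)).mul_left (75 / 256)
  refine ((measure_mono hsub).trans ((measure_iUnion_le _).trans
    (ENNReal.tsum_le_tsum (naturalMeasure_ball_le hε hε')))).trans_lt ?_
  rw [← ENNReal.ofReal_tsum_of_nonneg (fun k ↦ by positivity) hgeo.summable, hgeo.tsum_eq,
    ENNReal.ofReal_lt_one]
  norm_num

lemma not_countablyOneRectifiable_closedLimitSet {ε : ℝ} (hε : 0 < ε) (hε' : ε < 1 / 8) :
    ¬ CountablyOneRectifiable (closedLimitSet ε) := by
  intro h
  have hsub : (univ : Set ℂ) ⊆ (closedLimitSet ε ∪ (limitSet ε)ᶜ) ∪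
      ⋃ k ∈ Ici 1, Metric.ball (edgePoint ε k) (radius ε k) := by
    intro z _
    by_cases h1 : z ∈ limitSet ε
    · by_cases h2 : z ∈ ⋃ k ∈ Ici 1, Metric.ball (edgePoint ε k) (radius ε k)
      exacts [.inr h2, .inl (.inl ⟨h1, h2⟩)]
    · exact .inl (.inr h1)
  have hle := (measure_mono (μ := naturalMeasure ε) hsub).trans (measure_union_le _ _)
  rw [measure_union_null (h.naturalMeasure_eq_zero hε hε') (naturalMeasure_compl_limitSet hε hε'),
    naturalMeasure_univ hε hε', zero_add] at hle
  exact hle.not_gt (naturalMeasure_iUnion_ball_lt_one hε hε')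

end Koch

theorem mainTheorem7 (ε : ℝ) (hε : 0 < ε) (hε' : ε < 1 / 8) :
    (∀ x ∈ Koch.limitSet ε,
      (∀ n : ℕ, ∃! i : ℕ, i < 2 ^ n ∧ x ∈ Koch.cap ε n i) ∧
        Tendsto (Koch.stretch ε (Koch.capIndex ε x)) atTop atTop) ∧
    (∀ t ∈ Icc (0 : ℝ) 1, Tendsto (Koch.stretch ε (Koch.dyadicIndex t)) atTop atTop) ∧
    ¬ Koch.CountablyOneRectifiable (Koch.limitSet ε) ∧
    IsClosed (Koch.closedLimitSet ε) ∧
    ¬ Koch.CountablyOneRectifiable (Koch.closedLimitSet ε) :=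
  ⟨fun _ hx ↦ ⟨Koch.existsUnique_mem_cap hε hε' hx, Koch.tendsto_stretch hε _⟩,
    fun _ _ ↦ Koch.tendsto_stretch hε _,
    fun h ↦ Koch.not_countablyOneRectifiable_closedLimitSet hε hε' (h.mono sdiff_subset),
    Koch.isClosed_closedLimitSet hε hε',
    Koch.not_countablyOneRectifiable_closedLimitSet hε hε'⟩
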